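/- Let $p>0$ and let $X$ be a real random variable with $\mu_p := \mathbb E|X|^p$ satisfying $0<\mu_p<\infty$ and $\sigma_p^2 := \operatorname{Var}(|X|^p)<\infty$, $\sigma_p\ge 0$. For $x\in\mathbb R^d$ write $\|x\|_p=\big(\sum_{j=1}^d|x_j|^p\big)^{1/p}$. Fix an integer $n\ge 1$ and, for each $d\ge 1$, let $\mathbf X_1,\dots,\mathbf X_n$ be i.i.d. random vectors in $\mathbb R^d$ whose components are i.i.d. with the law of $X$. Then, as $d\to\infty$, $$d^{1/2-1/p}\Big(\max_{1\le i\le n}\|\mathbf X_i\|_p-\min_{1\le i\le n}\|\mathbf X_i\|_p\Big)\ \xrightarrow{\ \mathcal D\ }\ \frac{\sigma_p\,\mu_p^{1/p-1}}{p}\,M_n,$$ where $M_n=\max_{1\le i\le n}Z_i-\min_{1\le i\le n}Z_i$ for i.i.d. standard normal random variables $Z_1,\dots,Z_n$. -/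

import Mathlib

open MeasureTheory ProbabilityTheory Filter

/-- The `p`-norm (a prenorm if `p < 1`) of a vector of `ℝ^d`:
`‖x‖_p = (∑ j, |x j| ^ p) ^ (1 / p)`. -/
noncomputable def pNorm (p : ℝ) {d : ℕ} (x : Fin d → ℝ) : ℝ :=
  (∑ j, |x j| ^ p) ^ (1 / p)

/-- The range `max_{i} x i - min_{i} x i` of a finite (nonempty) real sample. -/
noncomputable def sampleRange {n : ℕ} (x : Fin n → ℝ) : ℝ :=
  (⨆ i, x i) - (⨅ i, x i)

/-- `μ_p = E |X| ^ p` (meaningful if `|X| ^ p` is integrable). -/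
noncomputable def absMoment {Ω : Type*} [MeasurableSpace Ω] (p : ℝ) (X : Ω → ℝ)
    (P : Measure Ω) : ℝ :=
  ∫ ω, |X ω| ^ p ∂P

/-- `σ_p`, the standard deviation of `|X| ^ p` (meaningful if `Var |X| ^ p < ∞`). -/
noncomputable def absSigma {Ω : Type*} [MeasurableSpace Ω] (p : ℝ) (X : Ω → ℝ)
    (P : Measure Ω) : ℝ :=
  √(variance (fun ω => |X ω| ^ p) P)

/-! The range ignores a common shift, so every norm may be centred at `(d * μ_p) ^ (1 / p)`. The
central limit theorem for the sums of `|X| ^ p`, with the delta method for `s ↦ s ^ (1 / p)` at `μ_p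
> 0`, gives each centred norm a Gaussian limit (`tendstoInDistribution_pNorm`). Independence makes
the convergence joint, and continuity of the range transfers it. -/

/-- Componentwise convergence in distribution of vectors with independent components implies
joint convergence in distribution, if the limit has independent components. -/
theorem TendstoInDistribution.pi_of_iIndepFun {ι κ Ω' : Type*} [Fintype κ] {Ω : ι → Type*}
    [∀ i, MeasurableSpace (Ω i)] [MeasurableSpace Ω'] {P : ∀ i, Measure (Ω i)}
    [∀ i, IsProbabilityMeasure (P i)] {P' : Measure Ω'} [IsProbabilityMeasure P'] {l : Filter ι}
    {T : ∀ i, κ → Ω i → ℝ} {Z : κ → Ω' → ℝ}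
    (h : ∀ k, TendstoInDistribution (fun i ↦ T i k) l (Z k) P P')
    (hT : ∀ i, iIndepFun (T i) (P i)) (hZ : iIndepFun Z P') :
    TendstoInDistribution (fun i ω k ↦ T i k ω) l (fun ω k ↦ Z k ω) P P' where
  forall_aemeasurable i := aemeasurable_pi_lambda _ fun k ↦ (h k).forall_aemeasurable i
  aemeasurable_limit := aemeasurable_pi_lambda _ fun k ↦ (h k).aemeasurable_limit
  tendsto := by
    have key := (ProbabilityMeasure.continuous_pi (ι := κ) (α := fun _ ↦ ℝ)).tendsto _ |>.comp
      (tendsto_pi_nhds.2 fun k ↦ (h k).tendsto)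
    have hlim : (⟨P'.map fun ω k ↦ Z k ω, Measure.isProbabilityMeasure_map
          (aemeasurable_pi_lambda _ fun k ↦ (h k).aemeasurable_limit)⟩ :
          ProbabilityMeasure (κ → ℝ)) = ProbabilityMeasure.pi fun k ↦
        ⟨P'.map (Z k), Measure.isProbabilityMeasure_map (h k).aemeasurable_limit⟩ :=
      Subtype.ext (hZ.map_fun_eq_pi_map fun k ↦ (h k).aemeasurable_limit)
    rw [hlim]
    exact key.congr fun i ↦ Subtype.ext
      ((hT i).map_fun_eq_pi_map fun k ↦ (h k).forall_aemeasurable i).symm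

/-- Convergence in distribution depends only on the laws of the random variables. -/
theorem TendstoInDistribution.of_identDistrib {ι E Ω' : Type*} {Ω Ω₁ : ι → Type*}
    [TopologicalSpace E] [MeasurableSpace E] [OpensMeasurableSpace E]
    [∀ i, MeasurableSpace (Ω i)] [∀ i, MeasurableSpace (Ω₁ i)] [MeasurableSpace Ω']
    {P : ∀ i, Measure (Ω i)} [∀ i, IsProbabilityMeasure (P i)]
    {P₁ : ∀ i, Measure (Ω₁ i)} [∀ i, IsProbabilityMeasure (P₁ i)]
    {P' : Measure Ω'} [IsProbabilityMeasure P'] {l : Filter ι}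
    {T : ∀ i, Ω i → E} {T₁ : ∀ i, Ω₁ i → E} {Z : Ω' → E}
    (h : TendstoInDistribution T l Z P P') (hT : ∀ i, IdentDistrib (T₁ i) (T i) (P₁ i) (P i)) :
    TendstoInDistribution T₁ l Z P₁ P' where
  forall_aemeasurable i := (hT i).aemeasurable_fst
  aemeasurable_limit := h.aemeasurable_limit
  tendsto := h.tendsto.congr fun i ↦ Subtype.ext (hT i).map_eq.symm

theorem continuous_sampleRange {n : ℕ} (hn : 1 ≤ n) :
    Continuous (sampleRange : (Fin n → ℝ) → ℝ) := by
  have : Nonempty (Fin n) := ⟨⟨0, hn⟩⟩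
  unfold sampleRange
  simp_rw [← Finset.sup'_univ_eq_ciSup, ← Finset.inf'_univ_eq_ciInf]
  exact (Continuous.finset_sup'_apply _ fun i _ ↦ continuous_apply i).sub
    (Continuous.finset_inf'_apply _ fun i _ ↦ continuous_apply i)

theorem sampleRange_const_mul {n : ℕ} {a : ℝ} (ha : 0 ≤ a) (x : Fin n → ℝ) :
    sampleRange (fun i ↦ a * x i) = a * sampleRange x := by
  unfold sampleRange
  rw [mul_sub, Real.mul_iSup_of_nonneg ha, Real.mul_iInf_of_nonneg ha]

theorem sampleRange_sub_const {n : ℕ} (hn : 1 ≤ n) (b : ℝ) (x : Fin n → ℝ) :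
    sampleRange (fun i ↦ x i - b) = sampleRange x := by
  have : Nonempty (Fin n) := ⟨⟨0, hn⟩⟩
  unfold sampleRange
  rw [← ciSup_sub (Set.finite_range x).bddAbove, ← ciInf_sub (Set.finite_range x).bddBelow]
  ring

/-- The factorization behind the delta method for `s ↦ s ^ r`. -/
theorem mul_rpow_sub_rpow_eq {r m s : ℝ} (hm : 0 ≤ m) (hs : 0 ≤ s) (hr : r ≠ 0) (d : ℕ)
    (hd : d = 0 → s = 0) :
    (d : ℝ) ^ (1 / 2 - r) * (s ^ r - (d * m) ^ r) =
      (√d)⁻¹ * (s - d * m) *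
        dslope (fun x ↦ x ^ r) m (m + (√d)⁻¹ * (s - d * m) * (√d)⁻¹) := by
  -- At `d = 0` both sides vanish, since `(√0)⁻¹ = 0`.
  rcases Nat.eq_zero_or_pos d with rfl | hpos
  · simp [hd rfl, Real.zero_rpow hr]
  have hd' : (0 : ℝ) < d := by exact_mod_cast hpos
  have hsq : √(d : ℝ) * √d = d := Real.mul_self_sqrt hd'.le
  have hsq0 : √(d : ℝ) ≠ 0 := (Real.sqrt_pos.2 hd').ne'
  have harg : m + (√d)⁻¹ * (s - d * m) * (√d)⁻¹ = s / d := by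
    have : (√(d : ℝ))⁻¹ * (s - d * m) * (√d)⁻¹ = (s - d * m) / d := by
      field_simp
      rw [Real.sq_sqrt hd'.le]
    rw [this]
    field_simp
    ring
  have hlin : (√(d : ℝ))⁻¹ * (s - d * m) = √d * (s / d - m) := by
    field_simp
    rw [Real.sq_sqrt hd'.le]
  rw [harg, hlin, mul_assoc, ← smul_eq_mul (s / d - m), sub_smul_dslope, Real.div_rpow hs hd'.le,
    Real.mul_rpow hd'.le hm, Real.rpow_sub hd', ← Real.sqrt_eq_rpow]
  have : (d : ℝ) ^ r ≠ 0 := (Real.rpow_pos_of_pos hd' r).ne'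
  field_simp

/-- **Delta method** for powers of sums of i.i.d. nonnegative variables. -/
theorem tendstoInDistribution_rpow_sum {Ω Ω' : Type*} [MeasurableSpace Ω] [MeasurableSpace Ω']
    {P : Measure Ω} [IsProbabilityMeasure P] {P' : Measure Ω'} [IsProbabilityMeasure P']
    {Y : ℕ → Ω → ℝ} {Z : Ω' → ℝ} {r : ℝ} (hr : 0 < r)
    (hZ : HasLaw Z (gaussianReal 0 1) P') (hY : MemLp (Y 0) 2 P) (hpos : 0 < P[Y 0])
    (hY0 : ∀ k ω, 0 ≤ Y k ω) (hindep : iIndepFun Y P)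
    (hident : ∀ k, IdentDistrib (Y k) (Y 0) P P) :
    TendstoInDistribution
      (fun (d : ℕ) ω ↦ (d : ℝ) ^ (1 / 2 - r) *
        ((∑ k ∈ Finset.range d, Y k ω) ^ r - (d * P[Y 0]) ^ r)) atTop
      (fun ω ↦ √Var[Y 0; P] * P[Y 0] ^ (r - 1) * r * Z ω) (fun _ ↦ P) P' := by
  set m := P[Y 0]
  -- Zero variance is allowed: the Gaussian law is then a Dirac mass.
  have hZ' : HasLaw (fun ω ↦ √Var[Y 0; P] * Z ω) (gaussianReal 0 Var[Y 0; P].toNNReal) P' := by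
    convert gaussianReal_const_mul hZ √Var[Y 0; P] using 2
    · simp
    · ext
      simp [Real.sq_sqrt (variance_nonneg _ _), variance_nonneg]
  have hclt := tendstoInDistribution_inv_sqrt_mul_sum_sub hZ' hY hindep hident
  have hdiff : HasDerivAt (fun x : ℝ ↦ x ^ r) (r * m ^ (r - 1)) m :=
    Real.hasDerivAt_rpow_const (Or.inl hpos.ne')
  -- `dslope` takes the derivative as its value at `m`, so the difference quotient is continuous
  -- everywhere and no Taylor remainder is needed.
  have hcont : Continuous (dslope (fun x : ℝ ↦ x ^ r) m) := by
    rw [← continuousOn_univ, continuousOn_dslope univ_mem]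
    exact ⟨(Real.continuous_rpow_const hr.le).continuousOn, hdiff.differentiableAt⟩
  -- Slutsky is applied at `x.1` the normalized sum and `x.2 = 1 / √d → 0`; at `x.2 = 0` only the
  -- derivative at `m` remains.
  have hg : Continuous fun x : ℝ × ℝ ↦ x.1 * dslope (fun x : ℝ ↦ x ^ r) m (m + x.1 * x.2) := by
    fun_prop
  have hzero : Tendsto (fun d : ℕ ↦ (√(d : ℝ))⁻¹) atTop (nhds 0) :=
    tendsto_inv_atTop_zero.comp (Real.tendsto_sqrt_atTop.comp tendsto_natCast_atTop_atTop)
  have hmeas : TendstoInMeasure P (fun (d : ℕ) (_ : Ω) ↦ (√(d : ℝ))⁻¹) atTop (fun _ ↦ 0) :=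
    tendstoInMeasure_of_tendsto_ae (fun _ ↦ aestronglyMeasurable_const) (ae_of_all _ fun _ ↦ hzero)
  have hslutsky := hclt.continuous_comp_prodMk_of_tendstoInMeasure_const hg hmeas
    fun _ ↦ aemeasurable_const
  refine hslutsky.congr (fun d ↦ ae_of_all _ fun ω ↦ ?_) (ae_of_all _ fun ω ↦ ?_)
  · exact (mul_rpow_sub_rpow_eq hpos.le (Finset.sum_nonneg fun k _ ↦ hY0 k ω) hr.ne' d
      (by rintro rfl; simp)).symm
  · simp only [mul_zero, add_zero, dslope_same, hdiff.deriv]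
    ring

theorem measurable_abs_rpow (p : ℝ) : Measurable fun x : ℝ ↦ |x| ^ p := by fun_prop

theorem measurable_pNorm (p : ℝ) (d : ℕ) : Measurable (pNorm p : (Fin d → ℝ) → ℝ) := by
  unfold pNorm
  fun_prop

/-- The centered and normalized `p`-norm of a vector with i.i.d. components is asymptotically
normal. -/
theorem tendstoInDistribution_pNorm {Ω₀ Ω' : Type*} [MeasurableSpace Ω₀] [MeasurableSpace Ω']
    {P₀ : Measure Ω₀} [IsProbabilityMeasure P₀] {P' : Measure Ω'} [IsProbabilityMeasure P']
    {X₀ : Ω₀ → ℝ} {p : ℝ} (hX₀ : AEMeasurable X₀ P₀) (hp : 0 < p)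
    (hpos : 0 < absMoment p X₀ P₀) (hvar : evariance (fun ω ↦ |X₀ ω| ^ p) P₀ < ⊤)
    {Ω : ℕ → Type*} [∀ d, MeasurableSpace (Ω d)] {P : ∀ d, Measure (Ω d)}
    [∀ d, IsProbabilityMeasure (P d)] {X : ∀ d, Ω d → (Fin d → ℝ)}
    (hindep : ∀ d, iIndepFun (fun (j : Fin d) ω ↦ X d ω j) (P d))
    (hlaw : ∀ d (j : Fin d), IdentDistrib (fun ω ↦ X d ω j) X₀ (P d) P₀)
    {Z : Ω' → ℝ} (hZ : HasLaw Z (gaussianReal 0 1) P') :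
    TendstoInDistribution
      (fun (d : ℕ) ω ↦ (d : ℝ) ^ (1 / 2 - 1 / p) *
        (pNorm p (X d ω) - (d * absMoment p X₀ P₀) ^ (1 / p))) atTop
      (fun ω ↦ absSigma p X₀ P₀ * absMoment p X₀ P₀ ^ (1 / p - 1) / p * Z ω) P P' := by
  have : IsProbabilityMeasure (P₀.map X₀) := Measure.isProbabilityMeasure_map hX₀
  -- The spaces `Ω d` are unrelated, while the limit theorem needs one sequence. `X d` has the law
  -- of the first `d` terms of `W`, which suffices.
  obtain ⟨Ω₁, _, P₁, W, hWm, hWlaw, hWindep, _⟩ := exists_iid ℕ (P₀.map X₀)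
  have hWX (k : ℕ) : IdentDistrib (W k) X₀ P₁ P₀ :=
    ⟨(hWm k).aemeasurable, hX₀, (hWlaw k).map_eq⟩
  have hYX (k : ℕ) : IdentDistrib (fun ω ↦ |W k ω| ^ p) (fun ω ↦ |X₀ ω| ^ p) P₁ P₀ :=
    (hWX k).comp (measurable_abs_rpow p)
  have hmem : MemLp (fun ω ↦ |X₀ ω| ^ p) 2 P₀ :=
    (evariance_lt_top_iff_memLp
      ((measurable_abs_rpow p).comp_aemeasurable hX₀).aestronglyMeasurable).1 hvar
  have hmean : P₁[fun ω ↦ |W 0 ω| ^ p] = absMoment p X₀ P₀ := (hYX 0).integral_eq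
  have hdelta := tendstoInDistribution_rpow_sum (r := 1 / p) (Y := fun k ω ↦ |W k ω| ^ p)
    (by positivity) hZ ((hYX 0).memLp_iff.2 hmem) (hmean ▸ hpos) (fun _ _ ↦ by positivity)
    (hWindep.comp _ fun _ ↦ measurable_abs_rpow p) fun k ↦ (hYX k).trans (hYX 0).symm
  rw [hmean, (hYX 0).variance_eq] at hdelta
  have hdelta' := TendstoInDistribution.of_identDistrib hdelta
    (T₁ := fun d ω ↦ (d : ℝ) ^ (1 / 2 - 1 / p) *
      (pNorm p (X d ω) - (d * absMoment p X₀ P₀) ^ (1 / p))) (P₁ := P) fun d ↦ by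
    have hvec : IdentDistrib (X d) (fun ω (j : Fin d) ↦ W j ω) (P d) P₁ :=
      IdentDistrib.pi (fun j ↦ (hlaw d j).trans (hWX j).symm) (hindep d)
        (hWindep.precomp Fin.val_injective)
    convert hvec.comp (u := fun x ↦ (d : ℝ) ^ (1 / 2 - 1 / p) *
      (pNorm p x - (d * absMoment p X₀ P₀) ^ (1 / p)))
      (((measurable_pNorm p d).sub_const _).const_mul _) using 1
    · funext ω
      simp
    · funext ω
      simp [pNorm, Finset.sum_range]
  convert hdelta' using 2
  unfold absSigma
  ring

/-- `X₀` is the generic variable, on `(Ω₀, P₀)`. For each dimension `d`, the random vectors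
`X d i`, `i : Fin n`, on a probability space `(Ω d, P d)` are an i.i.d. sample of vectors with
i.i.d. components distributed as `X₀`. The `Z i` are i.i.d. standard normal. -/
theorem mainTheorem2
    {Ω₀ : Type*} [MeasurableSpace Ω₀] (P₀ : Measure Ω₀) [IsProbabilityMeasure P₀]
    (X₀ : Ω₀ → ℝ) (hX₀ : AEMeasurable X₀ P₀)
    (p : ℝ) (hp : 0 < p)
    (hint : Integrable (fun ω => |X₀ ω| ^ p) P₀)
    (hpos : 0 < absMoment p X₀ P₀)
    (hvar : evariance (fun ω => |X₀ ω| ^ p) P₀ < ⊤)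
    (n : ℕ) (hn : 1 ≤ n)
    {Ω : ℕ → Type*} [∀ d, MeasurableSpace (Ω d)] (P : ∀ d, Measure (Ω d))
    [∀ d, IsProbabilityMeasure (P d)]
    (X : ∀ d, Fin n → Ω d → (Fin d → ℝ))
    (hX_indep : ∀ d, iIndepFun (X d) (P d))
    (hX_comp_indep : ∀ d i, iIndepFun (fun (j : Fin d) ω => X d i ω j) (P d))
    (hX_law : ∀ d i (j : Fin d), IdentDistrib (fun ω => X d i ω j) X₀ (P d) P₀)
    {Ω' : Type*} [MeasurableSpace Ω'] (P' : Measure Ω') [IsProbabilityMeasure P']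
    (Z : Fin n → Ω' → ℝ) (hZ_indep : iIndepFun Z P')
    (hZ_law : ∀ i, HasLaw (Z i) (gaussianReal 0 1) P') :
    TendstoInDistribution
      (fun (d : ℕ) ω =>
        (d : ℝ) ^ (1 / 2 - 1 / p : ℝ) * sampleRange (fun i => pNorm p (X d i ω)))
      atTop
      (fun ω =>
        absSigma p X₀ P₀ * absMoment p X₀ P₀ ^ (1 / p - 1) / p * sampleRange (fun i => Z i ω))
      P P' := by
  have hvec := TendstoInDistribution.pi_of_iIndepFun
    (T := fun (d : ℕ) i ω ↦ (d : ℝ) ^ (1 / 2 - 1 / p : ℝ) *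
      (pNorm p (X d i ω) - (d * absMoment p X₀ P₀) ^ (1 / p)))
    (fun i ↦ tendstoInDistribution_pNorm hX₀ hp hpos hvar (fun d ↦ hX_comp_indep d i)
      (fun d j ↦ hX_law d i j) (hZ_law i))
    (fun d ↦ (hX_indep d).comp (fun _ x ↦ (d : ℝ) ^ (1 / 2 - 1 / p : ℝ) *
      (pNorm p x - (d * absMoment p X₀ P₀) ^ (1 / p)))
      fun _ ↦ ((measurable_pNorm p d).sub_const _).const_mul _)
    (hZ_indep.comp (fun _ x ↦ absSigma p X₀ P₀ * absMoment p X₀ P₀ ^ (1 / p - 1) / p * x)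
      fun _ ↦ measurable_id.const_mul _)
  refine (hvec.continuous_comp (continuous_sampleRange hn)).congr
    (fun d ↦ ae_of_all _ fun ω ↦ ?_) (ae_of_all _ fun ω ↦ ?_)
  · simp only [Function.comp_apply]
    -- The centring does not depend on `i`, so it cancels.
    rw [sampleRange_const_mul (by positivity), sampleRange_sub_const hn]
  · exact sampleRange_const_mul
      (div_nonneg (mul_nonneg (Real.sqrt_nonneg _) (Real.rpow_nonneg hpos.le _)) hp.le) _
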